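/- Let $G$ be a compact topological group with normalized Haar measure $\mu$, acting continuously on $\mathbb{R}^d$ by orthogonal linear maps. Let $\varepsilon\in(0,1)$ and $s=1+\varepsilon$. A random template $t$ is obtained by drawing $v\sim\mathcal N(0,\tfrac1d I_d)$ and setting $t=v$ if $\|v\|_2^2<1+\varepsilon$ and $t=\perp$ otherwise; by convention the event $\langle x,gt\rangle\le\tau$ never occurs when $t=\perp$. For $x,z$ in the unit sphere $\mathbb{S}^{d-1}$ put $$\psi(x,t,\tau)=\mu\{g\in G:\langle x,gt\rangle\le\tau\},\qquad K_s(x,z)=\mathbb{E}_t\int_{-s}^{s}\psi(x,t,\tau)\,\psi(z,t,\tau)\,d\tau .$$ Given $m$ templates $t_1,\dots,t_m$, sampled group elements $g_1,\dots,g_{M}$ (with $M=|G|$ denoting the number of sampled elements) and a number of bins $n$, define the feature map $$\Phi(x)=\Big[\tfrac{\sqrt{s}}{\sqrt{nm}\,M}\sum_{i=1}^{M}\mathbf 1\{\langle g_it_j,x\rangle\le \tfrac{s}{n}k\}\Big]_{j=1,\dots,m,\;k=-n,\dots,n}\in\mathbb{R}^{(2n+1)\times m}.$$ There are universal numerical constants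 $C_1,C_2>0$ such that the following holds for all $d$, $G$, $\varepsilon$ as above, every finite family $x_1,\dots,x_N\in\mathbb{S}^{d-1}$ with $N\ge2$, and all $\varepsilon_0,\varepsilon_1,\varepsilon_2,\delta_1,\delta_2\in(0,1)$. If $$n\ge\frac1{\varepsilon_0},\qquad m\ge\frac{C_1}{\varepsilon_1^2}\log\frac{N}{\delta_1},\qquad M\ge\frac{C_2}{\varepsilon_2^2}\log\frac{Nm}{\delta_2},$$ and the templates $t_1,\dots,t_m$ (distributed as $t$) and the group elements $g_1,\dots,g_M$ (distributed according to $\mu$) are all independent, then with probability at least $1-\delta_1-\delta_2$, $$\big|\langle\Phi(x_i),\Phi(x_j)\rangle-K_s(x_i,x_j)\big|\le\varepsilon_0+\varepsilon_1+\varepsilon_2\qquad\text{for all } i,j\in\{1,\dots,N\}.$$ -/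

import Mathlib

open MeasureTheory ProbabilityTheory

noncomputable section

namespace InvFeatures

/-- The real Euclidean space `ℝ^d`. -/
abbrev E (d : ℕ) : Type := EuclideanSpace ℝ (Fin d)

/-- The Gaussian distribution `N(0, (1/d) I_d)` on `ℝ^d`: the law of `(1/√d) • Z` for a standard
Gaussian vector `Z`. -/
def gaussianVec (d : ℕ) : Measure (E d) :=
  (stdGaussian (E d)).map (fun v => (Real.sqrt d)⁻¹ • v)

/-- Rejection step of the template sampling: the Gaussian draw `v` is kept as a template if
`‖v‖² < 1 + ε`, and otherwise the template is `⊥` (here `none`). -/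
def reject {d : ℕ} (ε : ℝ) (v : E d) : Option (E d) :=
  open Classical in if ‖v‖ ^ 2 < 1 + ε then some v else none

variable {d : ℕ} {G : Type*} [Group G]

/-- The event `⟨x, g t⟩ ≤ τ` for a group element `g` acting through the orthogonal
representation `ρ`. It never occurs for the rejected template `t = ⊥`. -/
def Below (ρ : G →* (E d ≃ₗᵢ[ℝ] E d)) (x : E d) (g : G) (t : Option (E d)) (τ : ℝ) : Prop :=
  ∃ v, t = some v ∧ inner ℝ x (ρ g v) ≤ τ

/-- The cumulative distribution function `ψ(x, t, τ) = ℙ_g(⟨x, g t⟩ ≤ τ)`, for `g` distributed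
according to `μ`. -/
def psi [MeasurableSpace G] (ρ : G →* (E d ≃ₗᵢ[ℝ] E d)) (μ : Measure G)
    (x : E d) (t : Option (E d)) (τ : ℝ) : ℝ :=
  μ.real {g | Below ρ x g t τ}

/-- The expected kernel `K_s(x, z) = 𝔼_t ∫_{-s}^{s} ψ(x, t, τ) ψ(z, t, τ) dτ` with `s = 1 + ε`,
where `t` is obtained by Gaussian sampling with rejection. -/
def kernel [MeasurableSpace G] (ρ : G →* (E d ≃ₗᵢ[ℝ] E d)) (μ : Measure G) (ε : ℝ)
    (x z : E d) : ℝ :=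
  ∫ v, (∫ τ in (-(1 + ε))..(1 + ε),
    psi ρ μ x (reject ε v) τ * psi ρ μ z (reject ε v) τ) ∂(gaussianVec d)

/-- The coordinate `φ(x, t, s k / n)` of the feature map, `s = 1 + ε`, for `m` templates, `n` bins
and the `M` sampled group elements `g 0, …, g (M - 1)`:
`√s / (√(n m) M) * #{i | ⟨g i t, x⟩ ≤ (s / n) k}`. -/
def phi (ρ : G →* (E d ≃ₗᵢ[ℝ] E d)) (ε : ℝ) (n m : ℕ) {M : ℕ} (g : Fin M → G)
    (x : E d) (t : Option (E d)) (k : ℤ) : ℝ :=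
  open Classical in
  Real.sqrt (1 + ε) / (Real.sqrt (n * m) * M) *
    ∑ i : Fin M, if Below ρ x (g i) t ((1 + ε) / n * k) then (1 : ℝ) else 0

/-- The random feature map `Φ(x) = [φ(x, t_j, s k / n)]`, `j = 1, …, m`, `k = -n, …, n`, as a vector
in the Euclidean space of dimension `m (2 n + 1)`. -/
def Phi (ρ : G →* (E d ≃ₗᵢ[ℝ] E d)) (ε : ℝ) (n : ℕ) {m M : ℕ} (t : Fin m → Option (E d))
    (g : Fin M → G) (x : E d) : EuclideanSpace ℝ (Fin m × Finset.Icc (-(n : ℤ)) (n : ℤ)) :=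
  WithLp.toLp 2 fun p => phi ρ ε n m g x (t p.1) p.2

/-- The joint law of the samples: `m` Gaussian draws from `N(0, (1/d) I_d)` (from which the templates
are obtained by rejection) and `M` draws from `μ` on the group, all independent. -/
def sampleLaw [MeasurableSpace G] (d : ℕ) (μ : Measure G) (m M : ℕ) :
    Measure ((Fin m → E d) × (Fin M → G)) :=
  (Measure.pi fun _ : Fin m => gaussianVec d).prod (Measure.pi fun _ : Fin M => μ)

end InvFeatures

end

noncomputable section

/-! The inner product of two feature vectors is an average over templates of Riemann sums of mesh `h
= (1 + ε) / n`, with empirical distribution functions in place of `psi`. The error splits into three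
parts, one for each of `ε₂`, `ε₁`, `ε₀`.

Replacing empirical distribution functions by `psi` costs at most 12 times their mean absolute
deviation over the bins. Bounding this mean by Jensen, Markov and Hoeffding's moment bound
(`measure_sum_abs_deviation_ge_le`) avoids a union bound over bins, so `M` need not grow with `n`.
Replacing the template average of `riemannKernel` by its expectation is Hoeffding again.

The delicate part is discretization: the pointwise error can reach `h`, which may exceed `ε₀` when
`n` is close to `1 / ε₀`; an average error of `h / 2 ≤ 1 / n` is needed. A product of distribution
functions is the distribution function of a maximum of independent variables, so the error is `h`
times the mean of the fractional part of `max ⟨a,v⟩ ⟨b,v⟩ / h`, with `v` Gaussian and `a`, `b` unit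
vectors. By the Fourier series `fract y - 1/2 = -∑ sin (2πjy) / (πj)`, this mean is at most `1/2`
once all `𝔼 sin (c max ⟨a,v⟩ ⟨b,v⟩)`, `c ≥ 0`, are nonnegative
(`integral_sin_max_inner_stdGaussian_nonneg`). -/

/-! ### Nonnegativity of Gaussian sine expectations. -/

lemma integral_Ioi_sin_mul_exp_neg_mul_sq_nonneg {b : ℝ} (hb : 0 < b) :
    0 ≤ ∫ x in Set.Ioi (0 : ℝ), Real.sin x * Real.exp (-b * x ^ 2) := by
  -- Integration by parts with the nonnegative primitive `1 - cos` of `sin`: the boundary terms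
  -- vanish and the weight decreases.
  have hd : ∀ x ∈ Set.Ici (0 : ℝ), HasDerivAt (fun x => (1 - Real.cos x) * Real.exp (-b * x ^ 2))
      (Real.sin x * Real.exp (-b * x ^ 2)
        - 2 * b * ((1 - Real.cos x) * (x * Real.exp (-b * x ^ 2)))) x := by
    intro x _
    have h1 : HasDerivAt (fun x : ℝ => 1 - Real.cos x) (Real.sin x) x := by
      simpa using (Real.hasDerivAt_cos x).const_sub 1
    have h2 : HasDerivAt (fun x : ℝ => Real.exp (-b * x ^ 2))
        (Real.exp (-b * x ^ 2) * (-b * (2 * x))) x := by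
      have := ((hasDerivAt_pow 2 x).const_mul (-b)).exp
      simpa using this
    convert! h1.mul h2 using 1
    ring
  have i1 : IntegrableOn (fun x => Real.sin x * Real.exp (-b * x ^ 2)) (Set.Ioi 0) := by
    refine ((integrable_exp_neg_mul_sq hb).bdd_mul (c := 1) (by fun_prop) ?_).integrableOn
    exact .of_forall fun x => by simpa using Real.abs_sin_le_one x
  have i2 : IntegrableOn (fun x => (1 - Real.cos x) * (x * Real.exp (-b * x ^ 2)))
      (Set.Ioi 0) := by
    refine ((integrable_mul_exp_neg_mul_sq hb).bdd_mul (c := 2) (by fun_prop) ?_).integrableOn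
    refine .of_forall fun x => ?_
    rw [Real.norm_eq_abs, abs_le]
    constructor <;> linarith [Real.cos_le_one x, Real.neg_one_le_cos x]
  have hl : Filter.Tendsto (fun x => (1 - Real.cos x) * Real.exp (-b * x ^ 2)) Filter.atTop
      (nhds 0) := by
    have ht : Filter.Tendsto (fun x : ℝ => Real.exp (-b * x ^ 2)) Filter.atTop (nhds 0) := by
      refine Real.tendsto_exp_atBot.comp ?_
      exact (Filter.tendsto_pow_atTop (by norm_num)).const_mul_atTop_of_neg (by linarith)
    refine squeeze_zero (fun x => ?_) (fun x => ?_) (by simpa only [mul_zero] using ht.const_mul 2)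
    · exact mul_nonneg (by linarith [Real.cos_le_one x]) (Real.exp_pos _).le
    · exact mul_le_mul_of_nonneg_right (by linarith [Real.neg_one_le_cos x]) (Real.exp_pos _).le
  have key := integral_Ioi_of_hasDerivAt_of_tendsto' hd (i1.sub (i2.const_mul (2 * b))) hl
  rw [integral_sub i1 (i2.const_mul _), integral_const_mul] at key
  have : 0 ≤ ∫ x in Set.Ioi (0 : ℝ), (1 - Real.cos x) * (x * Real.exp (-b * x ^ 2)) := by
    refine setIntegral_nonneg measurableSet_Ioi fun x hx => ?_
    have hx : (0 : ℝ) < x := hx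
    exact mul_nonneg (by linarith [Real.cos_le_one x]) (by positivity)
  have : 0 ≤ 2 * b * ∫ x in Set.Ioi (0 : ℝ), (1 - Real.cos x) * (x * Real.exp (-b * x ^ 2)) := by
    positivity
  simp only [Real.cos_zero, sub_self, zero_mul] at key
  linarith

lemma integral_sin_abs_gaussianReal_nonneg (v : NNReal) :
    0 ≤ ∫ x, Real.sin |x| ∂(gaussianReal 0 v) := by
  by_cases hv : v = 0
  · subst hv
    simp [gaussianReal_zero_var]
  rw [integral_gaussianReal_eq_integral_smul hv]
  have : ∀ x : ℝ, gaussianPDFReal 0 v x • Real.sin |x| = (Real.sqrt (2 * Real.pi * v))⁻¹ *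
      (fun y => Real.sin y * Real.exp (-(2 * (v : ℝ))⁻¹ * y ^ 2)) |x| := by
    intro x
    simp only [gaussianPDFReal, smul_eq_mul, sq_abs, sub_zero]
    rw [show -x ^ 2 / (2 * (v : ℝ)) = -(2 * (v : ℝ))⁻¹ * x ^ 2 by ring]
    ring
  simp_rw [this]
  rw [integral_const_mul, integral_comp_abs (f := fun y => Real.sin y *
    Real.exp (-(2 * (v : ℝ))⁻¹ * y ^ 2))]
  have hv' : 0 < (v : ℝ) := by positivity
  have := integral_Ioi_sin_mul_exp_neg_mul_sq_nonneg (b := (2 * (v : ℝ))⁻¹) (by positivity)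
  positivity

section StdGaussian

variable {F : Type*} [NormedAddCommGroup F] [InnerProductSpace ℝ F] [FiniteDimensional ℝ F]
  [MeasurableSpace F] [BorelSpace F]

lemma hasGaussianLaw_inner_stdGaussian (a : F) :
    HasGaussianLaw (fun v : F => inner ℝ a v) (stdGaussian F) :=
  (IsGaussian.hasGaussianLaw_id (μ := stdGaussian F)).map_fun (innerSL ℝ a)

lemma map_inner_stdGaussian (a : F) :
    (stdGaussian F).map (fun v => inner ℝ a v) = gaussianReal 0 (‖a‖₊ ^ 2) := by
  rw [(hasGaussianLaw_inner_stdGaussian a).map_eq_gaussianReal]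
  have h1 := integral_strongDual_stdGaussian (innerSL ℝ a)
  have h2 := variance_dual_stdGaussian (innerSL ℝ a)
  simp only [innerSL_apply_norm] at h2
  change ∫ v, inner ℝ a v ∂_ = 0 at h1
  change Var[fun v => inner ℝ a v; _] = _ at h2
  rw [h1, h2]
  congr 1
  ext
  simp

lemma indepFun_inner_stdGaussian {a b : F} (hab : inner ℝ a b = 0) :
    IndepFun (fun v : F => inner ℝ a v) (fun v : F => inner ℝ b v) (stdGaussian F) := by
  have h : HasGaussianLaw (fun v : F => (inner ℝ a v, inner ℝ b v)) (stdGaussian F) :=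
    (IsGaussian.hasGaussianLaw_id (μ := stdGaussian F)).map_fun
      ((innerSL ℝ a).prod (innerSL ℝ b))
  refine h.indepFun_of_covariance_eq_zero ?_
  have := congrArg (fun B => B a b) (covarianceBilin_stdGaussian (E := F))
  rw [covarianceBilin_apply_eq_cov IsGaussian.memLp_two_id] at this
  exact this.trans hab

/-- The maximum is `⟨p,v⟩ + |⟨q,v⟩|` with `p`, `q` the half sum and half difference. Equal norms
make `p` and `q` orthogonal, hence the two Gaussians independent. In the addition formula the term
with `𝔼 sin ⟨p,v⟩` vanishes by symmetry, and the other is a product of nonnegative factors. -/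
lemma integral_sin_max_inner_stdGaussian_nonneg {a b : F} (hab : ‖a‖ = ‖b‖) :
    0 ≤ ∫ v, Real.sin (max (inner ℝ a v) (inner ℝ b v)) ∂(stdGaussian F) := by
  set p : F := (2 : ℝ)⁻¹ • (a + b)
  set q : F := (2 : ℝ)⁻¹ • (a - b)
  have hpq : inner ℝ p q = 0 := by
    simp only [p, q, real_inner_smul_left, real_inner_smul_right]
    have : inner ℝ (a + b) (a - b) = 0 := by
      rw [real_inner_add_sub_eq_zero_iff]; exact hab
    rw [this]; simp
  have hind := indepFun_inner_stdGaussian hpq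
  have hmax : ∀ v : F, Real.sin (max (inner ℝ a v) (inner ℝ b v)) =
      Real.sin (inner ℝ p v) * Real.cos |inner ℝ q v| +
        Real.cos (inner ℝ p v) * Real.sin |inner ℝ q v| := by
    intro v
    rw [← Real.sin_add]
    congr 1
    have h := sup_eq_half_smul_add_add_abs_sub' ℝ (inner ℝ a v) (inner ℝ b v : ℝ)
    rw [smul_eq_mul, abs_sub_comm] at h
    rw [h]
    simp only [p, q, real_inner_smul_left, inner_add_left, inner_sub_left, abs_mul]
    rw [abs_of_pos (show (0 : ℝ) < 2⁻¹ by norm_num)]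
    ring
  have hc := charFun_stdGaussian (E := F) p
  have hsin : ∫ v, Real.sin (inner ℝ p v) ∂(stdGaussian F) = 0 := by
    have hm : AEMeasurable (fun v : F => inner ℝ p v) (stdGaussian F) := by fun_prop
    rw [← integral_map (f := Real.sin) hm (by fun_prop), map_inner_stdGaussian]
    have h := integral_map (μ := gaussianReal 0 (‖p‖₊ ^ 2)) (φ := fun x : ℝ => -x) (f := Real.sin)
      (by fun_prop) (by fun_prop)
    rw [gaussianReal_map_neg] at h
    simp only [neg_zero, Real.sin_neg, integral_neg] at h
    linarith
  have hcos : 0 ≤ ∫ v, Real.cos (inner ℝ p v) ∂(stdGaussian F) := by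
    rw [charFun_apply] at hc
    have := congrArg Complex.re hc
    rw [← RCLike.re_eq_complex_re, ← integral_re] at this
    · simp only [RCLike.re_eq_complex_re, Complex.exp_ofReal_mul_I_re] at this
      simp_rw [fun v : F => real_inner_comm v p]
      rw [this]
      rw [show (-(‖p‖ : ℂ) ^ 2 / 2) = ((-‖p‖ ^ 2 / 2 : ℝ) : ℂ) by push_cast; ring,
        ← Complex.ofReal_exp, Complex.ofReal_re]
      positivity
    · refine Integrable.of_bound (C := 1) (by fun_prop) (.of_forall fun v => ?_)
      rw [Complex.norm_exp_ofReal_mul_I]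
  have hsa : 0 ≤ ∫ v, Real.sin |inner ℝ q v| ∂(stdGaussian F) := by
    have hm : AEMeasurable (fun v : F => inner ℝ q v) (stdGaussian F) := by fun_prop
    rw [← integral_map (f := fun x => Real.sin |x|) hm (by fun_prop), map_inner_stdGaussian]
    exact integral_sin_abs_gaussianReal_nonneg _
  have i1 : Integrable (fun v : F => Real.sin (inner ℝ p v) * Real.cos |inner ℝ q v|)
      (stdGaussian F) := by
    refine Integrable.of_bound (C := 1) (by fun_prop) (.of_forall fun v => ?_)
    rw [norm_mul]
    exact mul_le_one₀ (Real.abs_sin_le_one _) (norm_nonneg _) (Real.abs_cos_le_one _)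
  have i2 : Integrable (fun v : F => Real.cos (inner ℝ p v) * Real.sin |inner ℝ q v|)
      (stdGaussian F) := by
    refine Integrable.of_bound (C := 1) (by fun_prop) (.of_forall fun v => ?_)
    rw [norm_mul]
    exact mul_le_one₀ (Real.abs_cos_le_one _) (norm_nonneg _) (Real.abs_sin_le_one _)
  simp_rw [hmax]
  rw [integral_add i1 i2]
  have e1 := (hind.comp (φ := Real.sin) (ψ := fun x => Real.cos |x|) (by fun_prop)
    (by fun_prop)).integral_fun_mul_eq_mul_integral (by fun_prop) (by fun_prop)
  have e2 := (hind.comp (φ := Real.cos) (ψ := fun x => Real.sin |x|) (by fun_prop)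
    (by fun_prop)).integral_fun_mul_eq_mul_integral (by fun_prop) (by fun_prop)
  simp only [Function.comp_def] at e1 e2
  rw [e1, e2, hsin]
  have := mul_nonneg hcos hsa
  linarith

end StdGaussian

/-! ### The sawtooth function and its Fourier series. -/

lemma arg_one_sub_exp_two_pi_mul_I {y : ℝ} (hy : Int.fract y ≠ 0) :
    Complex.arg (1 - Complex.exp ((2 * Real.pi * y : ℝ) * Complex.I)) =
      Real.pi * (Int.fract y - 1 / 2) := by
  set f := Int.fract y
  have hf0 : 0 < f := lt_of_le_of_ne (Int.fract_nonneg y) (Ne.symm hy)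
  have hf1 : f < 1 := Int.fract_lt_one y
  have hpi := Real.pi_pos
  have he : Complex.exp ((2 * Real.pi * y : ℝ) * Complex.I) =
      Complex.exp ((2 * Real.pi * f : ℝ) * Complex.I) := by
    rw [Complex.exp_eq_exp_iff_exists_int]
    refine ⟨⌊y⌋, ?_⟩
    have : (y : ℂ) = f + ⌊y⌋ := by
      exact_mod_cast (Int.fract_add_floor y).symm
    push_cast
    rw [this]
    ring
  have hs : 0 < Real.sin (Real.pi * f) :=
    Real.sin_pos_of_pos_of_lt_pi (by positivity) (by nlinarith)
  have hz : 1 - Complex.exp ((2 * Real.pi * f : ℝ) * Complex.I) =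
      ((2 * Real.sin (Real.pi * f) : ℝ) : ℂ) *
        (Complex.cos ((Real.pi * (f - 1 / 2) : ℝ) : ℂ) +
          Complex.sin ((Real.pi * (f - 1 / 2) : ℝ) : ℂ) * Complex.I) := by
    have e : Real.pi * (f - 1 / 2) = Real.pi * f - Real.pi / 2 := by ring
    rw [e, Complex.exp_mul_I, ← Complex.ofReal_cos, ← Complex.ofReal_sin, ← Complex.ofReal_cos,
      ← Complex.ofReal_sin, Real.cos_sub_pi_div_two, Real.sin_sub_pi_div_two,
      show 2 * Real.pi * f = 2 * (Real.pi * f) by ring, Real.cos_two_mul, Real.sin_two_mul]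
    have := Real.sin_sq_add_cos_sq (Real.pi * f)
    generalize Real.sin (Real.pi * f) = S at this
    generalize Real.cos (Real.pi * f) = C at this
    apply Complex.ext
    · simp [pow_two]
      nlinarith
    · simp [pow_two]
  rw [he, hz, Complex.arg_mul_cos_add_sin_mul_I (by positivity)]
  constructor <;> nlinarith

/-- The sawtooth series converges only conditionally, so it is Abel summed: for `r < 1`, `arg (1 - r
e)` is minus an absolutely convergent sine series, which integrates termwise, and `r → 1` is taken
under the bound `|arg| ≤ π`. -/
lemma integral_fract_le_half {Ω : Type*} [MeasurableSpace Ω] {P : Measure Ω}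
    [IsProbabilityMeasure P] {Y : Ω → ℝ} (hY : Measurable Y)
    (hint : ∀ᵐ ω ∂P, Int.fract (Y ω) ≠ 0)
    (hsin : ∀ j : ℕ, 0 ≤ ∫ ω, Real.sin (2 * Real.pi * j * Y ω) ∂P) :
    ∫ ω, Int.fract (Y ω) ∂P ≤ 1 / 2 := by
  set e : Ω → ℂ := fun ω => Complex.exp ((2 * Real.pi * Y ω : ℝ) * Complex.I) with he
  have hem : Measurable e := by fun_prop
  have hen : ∀ ω, ‖e ω‖ = 1 := fun ω => Complex.norm_exp_ofReal_mul_I _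
  have hepow : ∀ ω (j : ℕ), (e ω ^ j).im = Real.sin (2 * Real.pi * j * Y ω) := by
    intro ω j
    rw [he, ← Complex.exp_nat_mul, ← Complex.exp_ofReal_mul_I_im]
    congr 2
    push_cast
    ring
  -- Abel means have nonpositive expectation
  have hr : ∀ r : ℝ, 0 ≤ r → r < 1 → ∫ ω, Complex.arg (1 - r * e ω) ∂P ≤ 0 := by
    intro r hr0 hr1
    have hs : ∀ ω, HasSum (fun j : ℕ => r ^ j / j * Real.sin (2 * Real.pi * j * Y ω))
        (-Complex.arg (1 - r * e ω)) := by
      intro ω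
      have hn : ‖(r : ℂ) * e ω‖ < 1 := by
        rw [norm_mul, hen, mul_one, Complex.norm_real, Real.norm_of_nonneg hr0]; exact hr1
      have := Complex.hasSum_im (Complex.hasSum_taylorSeries_neg_log hn)
      rw [Complex.neg_im, Complex.log_im] at this
      convert! this using 2 with j
      rw [mul_pow, ← hepow, mul_div_right_comm, ← Complex.ofReal_pow, ← Complex.ofReal_natCast,
        ← Complex.ofReal_div, Complex.im_ofReal_mul]
    have hbound : ∀ j : ℕ, ∀ ω, ‖r ^ j / j * Real.sin (2 * Real.pi * j * Y ω)‖ ≤ r ^ j := by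
      intro j ω
      rw [norm_mul, Real.norm_of_nonneg (by positivity)]
      have h1 : r ^ j / (j : ℝ) ≤ r ^ j := by
        rcases Nat.eq_zero_or_pos j with h | h
        · subst h; simp
        · exact div_le_self (by positivity) (by exact_mod_cast h)
      calc _ ≤ r ^ j * 1 := mul_le_mul h1 (Real.abs_sin_le_one _) (abs_nonneg _) (by positivity)
        _ = _ := mul_one _
    have hsum := hasSum_integral_of_dominated_convergence (μ := P) (fun (j : ℕ) (_ : Ω) => r ^ j)
      (F := fun (j : ℕ) ω => r ^ j / j * Real.sin (2 * Real.pi * j * Y ω))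
      (fun j => by fun_prop) (fun j => .of_forall (hbound j))
      (.of_forall fun _ => summable_geometric_of_lt_one hr0 hr1) (integrable_const _)
      (.of_forall hs)
    have hnn := hsum.nonneg fun j => by
      rw [integral_const_mul]
      exact mul_nonneg (by positivity) (hsin j)
    rw [integral_neg] at hnn
    linarith
  have hlim : Filter.Tendsto (fun r : ℝ => ∫ ω, Complex.arg (1 - r * e ω) ∂P)
      (nhdsWithin 1 (Set.Ico 0 1)) (nhds (∫ ω, Complex.arg (1 - e ω) ∂P)) := by
    refine tendsto_integral_filter_of_dominated_convergence (fun _ => Real.pi)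
      (.of_forall fun r => ?_) (.of_forall fun r => .of_forall fun ω => Complex.abs_arg_le_pi _)
      (integrable_const _) ?_
    · exact (Complex.measurable_arg.comp (by fun_prop)).aestronglyMeasurable
    · filter_upwards [hint] with ω hω
      -- Off the integers `1 - e ω` is nonzero with argument less than `π`, so `arg` is continuous
      -- there.
      have hmem : 1 - e ω ∈ Complex.slitPlane := by
        rw [Complex.mem_slitPlane_iff_arg]
        have harg := arg_one_sub_exp_two_pi_mul_I hω
        have := Int.fract_lt_one (Y ω)
        have h0 : 0 < Int.fract (Y ω) := lt_of_le_of_ne (Int.fract_nonneg _) (Ne.symm hω)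
        refine ⟨?_, fun h => ?_⟩
        · rw [harg]
          nlinarith [Real.pi_pos]
        · have hre := congrArg Complex.re h
          have h1 : e ω = 1 := by rw [sub_eq_zero] at h; exact h.symm
          rw [he, Complex.exp_eq_one_iff] at h1
          obtain ⟨k, hk⟩ := h1
          have hk' : 2 * Real.pi * Y ω = k * (2 * Real.pi) := by
            have := congrArg Complex.im hk
            simpa using this
          have : Y ω = k := by
            have := Real.pi_pos
            field_simp at hk'
            linarith
          rw [this] at hω
          simp at hω
      have hc : ContinuousAt (fun r : ℝ => Complex.arg (1 - r * e ω)) 1 := by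
        refine ContinuousAt.comp (g := Complex.arg) ?_ (by fun_prop)
        simpa using Complex.continuousAt_arg hmem
      have := hc.tendsto
      simp only [Complex.ofReal_one, one_mul] at this
      exact this.mono_left nhdsWithin_le_nhds
  have hne : (nhdsWithin (1 : ℝ) (Set.Ico 0 1)).NeBot := by
    rw [← mem_closure_iff_nhdsWithin_neBot, closure_Ico (by norm_num)]
    simp
  have hle : ∫ ω, Complex.arg (1 - e ω) ∂P ≤ 0 :=
    le_of_tendsto hlim (by
      filter_upwards [self_mem_nhdsWithin] with r hr'
      exact hr r hr'.1 hr'.2)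
  have heq : ∫ ω, Complex.arg (1 - e ω) ∂P = Real.pi * (∫ ω, Int.fract (Y ω) ∂P - 1 / 2) := by
    rw [integral_congr_ae (g := fun ω => Real.pi * (Int.fract (Y ω) - 1 / 2))
      (hint.mono fun ω hω => arg_one_sub_exp_two_pi_mul_I hω), integral_const_mul, integral_sub]
    · simp
    · refine Integrable.of_bound (C := 1) hY.fract.aestronglyMeasurable (.of_forall fun ω => ?_)
      rw [Real.norm_of_nonneg (Int.fract_nonneg _)]
      exact (Int.fract_lt_one _).le
    · exact integrable_const _
  rw [heq] at hle
  nlinarith [Real.pi_pos]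

/-! ### Mean fractional part of a maximum of two Gaussian projections. -/

namespace InvFeatures

instance isProbabilityMeasure_gaussianVec (d : ℕ) : IsProbabilityMeasure (gaussianVec d) :=
  Measure.isProbabilityMeasure_map (by fun_prop)

lemma pos_of_norm_eq_one {d : ℕ} {a : E d} (ha : ‖a‖ = 1) : 0 < d := by
  rcases Nat.eq_zero_or_pos d with h | h
  · subst h
    rw [Subsingleton.elim a 0] at ha
    simp at ha
  · exact h

lemma ae_fract_inner_div_ne_zero {d : ℕ} {a : E d} (ha : ‖a‖ = 1) {h : ℝ} (hh : 0 < h) :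
    ∀ᵐ v ∂(gaussianVec d), Int.fract (inner ℝ a v / h) ≠ 0 := by
  have hd : (0 : ℝ) < d := by exact_mod_cast pos_of_norm_eq_one ha
  have hmap : (gaussianVec d).map (fun v => inner ℝ a v)
      = gaussianReal 0 (‖(Real.sqrt d)⁻¹ • a‖₊ ^ 2) := by
    rw [← map_inner_stdGaussian, gaussianVec, Measure.map_map (by fun_prop) (by fun_prop)]
    congr 1
    ext v
    simp [real_inner_smul_left, real_inner_smul_right]
  have hne : ‖(Real.sqrt d)⁻¹ • a‖₊ ^ 2 ≠ 0 := by
    rw [Ne, sq_eq_zero_iff, nnnorm_eq_zero, smul_eq_zero, not_or]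
    refine ⟨by positivity, fun h0 => ?_⟩
    rw [h0] at ha
    simp at ha
  have := nullSingletonClass_gaussianReal (μ := 0) hne
  have hc : (Set.range fun k : ℤ => h * (k : ℝ)).Countable := Set.countable_range _
  have h0 : ∀ᵐ y ∂((gaussianVec d).map fun v => inner ℝ a v),
      y ∉ Set.range fun k : ℤ => h * (k : ℝ) := by
    rw [hmap]
    exact hc.ae_notMem _
  filter_upwards [ae_of_ae_map (by fun_prop) h0] with v hv hf
  refine hv ⟨⌊inner ℝ a v / h⌋, ?_⟩
  have := Int.floor_add_fract (inner ℝ a v / h)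
  rw [hf, add_zero] at this
  simp only
  rw [this]
  field_simp

/-- Projections almost surely avoid the grid, where the integrand differs from `fract (max / h)`.
Each Fourier frequency only rescales `a` and `b` by a common factor, which keeps their norms equal.
-/
lemma integral_one_sub_fract_neg_max_le {d : ℕ} {a b : E d} (ha : ‖a‖ = 1) (hb : ‖b‖ = 1)
    {h : ℝ} (hh : 0 < h) :
    ∫ v, (1 - Int.fract (-(max (inner ℝ a v) (inner ℝ b v) / h))) ∂(gaussianVec d) ≤ 1 / 2 := by
  have hint : ∀ᵐ v ∂(gaussianVec d),
      Int.fract (max (inner ℝ a v) (inner ℝ b v) / h) ≠ 0 := by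
    filter_upwards [ae_fract_inner_div_ne_zero ha hh, ae_fract_inner_div_ne_zero hb hh] with v h1 h2
    rcases max_choice (inner ℝ a v : ℝ) (inner ℝ b v) with h | h <;> rw [h] <;> assumption
  rw [integral_congr_ae (g := fun v => Int.fract (max (inner ℝ a v) (inner ℝ b v) / h))]
  · refine integral_fract_le_half (by fun_prop) hint fun j => ?_
    rw [gaussianVec, integral_map (by fun_prop) (by fun_prop)]
    set c : ℝ := 2 * Real.pi * j / h * (Real.sqrt d)⁻¹ with hc
    have hc0 : 0 ≤ c := by positivity
    have := integral_sin_max_inner_stdGaussian_nonneg (a := c • a) (b := c • b)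
      (by rw [norm_smul, norm_smul, ha, hb])
    convert! this using 4 with v
    simp only [real_inner_smul_left, real_inner_smul_right]
    rw [← mul_max_of_nonneg _ _ hc0, ← mul_max_of_nonneg _ _ (by positivity), hc]
    field_simp
  · filter_upwards [hint] with v hv
    rw [Int.fract_neg hv]
    ring

end InvFeatures

/-! ### Riemann sums of products of distribution functions. -/

/-- Deviation of the right-endpoint count of the half-line `[y, ∞)` on the grid of mesh `h`. -/
lemma grid_count_sub_integral {n : ℕ} {h y : ℝ} (hh : 0 < h) (hy : |y| ≤ h * n) :
    (h * ∑ k ∈ Finset.Icc (-(n : ℤ)) n, if y ≤ h * k then (1 : ℝ) else 0)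
      - ∫ τ in (-(h * n))..(h * n), (if y ≤ τ then (1 : ℝ) else 0)
      = h * (1 - Int.fract (-(y / h))) := by
  obtain ⟨hy1, hy2⟩ := abs_le.1 hy
  have hI : ∫ τ in (-(h * n))..(h * n), (if y ≤ τ then (1 : ℝ) else 0) = h * n - y := by
    rw [intervalIntegral.integral_of_le (by linarith)]
    have : (fun τ => if y ≤ τ then (1 : ℝ) else 0) = (Set.Ici y).indicator fun _ => 1 := by
      ext τ; simp [Set.indicator_apply]
    rw [this, integral_Ioc_eq_integral_Ioo, ← integral_Icc_eq_integral_Ioo,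
      setIntegral_indicator measurableSet_Ici]
    have h2 : Set.Icc (-(h * n)) (h * n) ∩ Set.Ici y = Set.Icc y (h * n) := by
      ext τ
      simp only [Set.mem_inter_iff, Set.mem_Icc, Set.mem_Ici]
      constructor
      · rintro ⟨⟨_, h3⟩, h4⟩; exact ⟨h4, h3⟩
      · rintro ⟨h3, h4⟩; exact ⟨⟨by linarith, h4⟩, h3⟩
    rw [h2]
    simp [hy2]
  have hS : (∑ k ∈ Finset.Icc (-(n : ℤ)) n, if y ≤ h * k then (1 : ℝ) else 0)
      = n + 1 - ⌈y / h⌉ := by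
    rw [Finset.sum_boole]
    have hf : (Finset.Icc (-(n : ℤ)) n).filter (fun k : ℤ => y ≤ h * k) =
        Finset.Icc ⌈y / h⌉ n := by
      -- Since `y ≥ -h n`, the lower limit `k ≥ -n` is implied by `k ≥ ⌈y / h⌉`.
      ext k
      simp only [Finset.mem_filter, Finset.mem_Icc]
      have e : y ≤ h * k ↔ ⌈y / h⌉ ≤ k := by
        rw [Int.ceil_le, div_le_iff₀ hh, mul_comm]
      rw [e]
      have : -(n : ℤ) ≤ ⌈y / h⌉ := by
        have h3 : ((-(n : ℤ) : ℤ) : ℝ) ≤ y / h := by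
          push_cast
          rw [le_div_iff₀ hh]
          linarith
        exact_mod_cast h3.trans (Int.le_ceil _)
      constructor
      · rintro ⟨⟨_, h3⟩, h4⟩; exact ⟨h4, h3⟩
      · rintro ⟨h3, h4⟩; exact ⟨⟨by linarith, h4⟩, h3⟩
    rw [hf, Int.card_Icc]
    have h5 : ⌈y / h⌉ ≤ (n : ℤ) := by
      rw [Int.ceil_le, div_le_iff₀ hh]
      push_cast
      linarith
    have h6 : (((n + 1 - ⌈y / h⌉).toNat : ℤ) : ℝ) = ((n + 1 - ⌈y / h⌉ : ℤ) : ℝ) := by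
      rw [Int.toNat_of_nonneg (by linarith)]
    push_cast at h6 ⊢
    exact h6
  rw [hI, hS, Int.fract, Int.floor_neg]
  push_cast
  field_simp
  ring

/-- The product at `τ` is the probability that `max (f p.1) (g p.2) ≤ τ` for independent `p.1`,
`p.2`; Fubini then reduces to one half-line per pair. -/
lemma riemann_sub_integral_cdf_mul {α : Type*} [MeasurableSpace α] {μ : Measure α}
    [IsProbabilityMeasure μ] {f g : α → ℝ} (hf : Measurable f) (hg : Measurable g)
    {n : ℕ} {h : ℝ} (hh : 0 < h) (hfb : ∀ a, |f a| ≤ h * n) (hgb : ∀ a, |g a| ≤ h * n) :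
    (h * ∑ k ∈ Finset.Icc (-(n : ℤ)) n, μ.real {a | f a ≤ h * k} * μ.real {a | g a ≤ h * k})
      - ∫ τ in (-(h * n))..(h * n), μ.real {a | f a ≤ τ} * μ.real {a | g a ≤ τ}
      = ∫ p, h * (1 - Int.fract (-(max (f p.1) (g p.2) / h))) ∂(μ.prod μ) := by
  have hprod : ∀ τ : ℝ, μ.real {a | f a ≤ τ} * μ.real {a | g a ≤ τ} =
      ∫ p, (if max (f p.1) (g p.2) ≤ τ then (1 : ℝ) else 0) ∂(μ.prod μ) := by
    intro τ
    rw [← measureReal_prod_prod, ← integral_indicator_one]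
    · congr 1
      ext p
      simp [Set.indicator_apply]
    · exact (measurableSet_le hf measurable_const).prod (measurableSet_le hg measurable_const)
  have hmm : Measurable fun p : α × α => max (f p.1) (g p.2) := by fun_prop
  have hk : ∀ τ : ℝ, Integrable
      (fun p : α × α => if max (f p.1) (g p.2) ≤ τ then (1 : ℝ) else 0) (μ.prod μ) := by
    intro τ
    refine Integrable.of_bound (C := 1) (Measurable.aestronglyMeasurable ?_)
      (.of_forall fun p => ?_)
    · exact Measurable.ite (measurableSet_le hmm measurable_const) measurable_const measurable_const
    · split_ifs <;> simp
  simp_rw [hprod]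
  have hjm : Measurable fun q : ℝ × (α × α) =>
      if max (f q.2.1) (g q.2.2) ≤ q.1 then (1 : ℝ) else 0 :=
    Measurable.ite (measurableSet_le (by fun_prop) (by fun_prop)) measurable_const measurable_const
  have hle : -(h * n) ≤ h * n := by
    have : 0 ≤ h * n := by positivity
    linarith
  have hji : Integrable (Function.uncurry fun (τ : ℝ) (p : α × α) =>
      if max (f p.1) (g p.2) ≤ τ then (1 : ℝ) else 0)
      ((volume.restrict (Set.Ioc (-(h * n)) (h * n))).prod (μ.prod μ)) := by
    refine Integrable.of_bound (C := 1) hjm.aestronglyMeasurable (.of_forall fun p => ?_)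
    simp only [Function.uncurry]
    split_ifs <;> simp
  have hswap : ∫ τ in (-(h * n))..(h * n),
        (∫ p, (if max (f p.1) (g p.2) ≤ τ then (1 : ℝ) else 0) ∂(μ.prod μ))
      = ∫ p, (∫ τ in (-(h * n))..(h * n), if max (f p.1) (g p.2) ≤ τ then (1 : ℝ) else 0)
          ∂(μ.prod μ) := by
    simp_rw [intervalIntegral.integral_of_le hle]
    exact integral_integral_swap hji
  rw [hswap, ← integral_finsetSum _ fun k _ => hk _, ← integral_const_mul, ← integral_sub]
  · refine integral_congr_ae (.of_forall fun p => ?_)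
    refine grid_count_sub_integral hh ?_
    rcases max_choice (f p.1) (g p.2) with h | h <;> rw [h]
    exacts [hfb _, hgb _]
  · exact (integrable_finsetSum _ fun k _ => hk _).const_mul _
  · simp_rw [intervalIntegral.integral_of_le hle]
    exact hji.integral_prod_right

/-! ### Concentration of empirical means. -/

lemma hasSubgaussianMGF_mean_sub_integral {α : Type*} [MeasurableSpace α] {P : Measure α}
    [IsProbabilityMeasure P] {M : ℕ} (hM : 0 < M) {f : α → ℝ} (hf : Measurable f)
    (hf01 : ∀ a, f a ∈ Set.Icc (0 : ℝ) 1) :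
    HasSubgaussianMGF (fun ω : Fin M → α => (∑ i, f (ω i)) / M - ∫ a, f a ∂P)
      (1 / (4 * M)) (Measure.pi fun _ => P) := by
  have h1 : HasSubgaussianMGF (fun a => f a - ∫ a, f a ∂P) ((‖(1 : ℝ) - 0‖₊ / 2) ^ 2) P :=
    hasSubgaussianMGF_of_mem_Icc hf.aemeasurable (.of_forall hf01)
  have hind : iIndepFun (fun (i : Fin M) (ω : Fin M → α) => f (ω i) - ∫ a, f a ∂P)
      (Measure.pi fun _ => P) :=
    iIndepFun_pi (X := fun _ a => f a - ∫ a, f a ∂P) fun _ => by fun_prop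
  have hi : ∀ i : Fin M, HasSubgaussianMGF (fun ω : Fin M → α => f (ω i) - ∫ a, f a ∂P)
      ((‖(1 : ℝ) - 0‖₊ / 2) ^ 2) (Measure.pi fun _ => P) := by
    intro i
    have hmp := measurePreserving_eval (fun _ : Fin M => P) i
    rw [← hmp.map_eq] at h1
    have := HasSubgaussianMGF.of_map hmp.aemeasurable h1
    rw [hmp.map_eq] at this
    exact this
  have hs := (HasSubgaussianMGF.sum_of_iIndepFun hind (s := Finset.univ) fun i _ => hi i).const_mul
    ((M : ℝ)⁻¹)
  have hM' : (M : ℝ) ≠ 0 := by positivity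
  convert! hs using 1
  · ext ω
    rw [Finset.sum_sub_distrib]
    simp only [Finset.sum_const, Finset.card_univ, Fintype.card_fin, nsmul_eq_mul]
    field_simp
  · ext
    change _ = (M : ℝ)⁻¹ ^ 2 * ((∑ _i : Fin M, (‖(1 : ℝ) - 0‖₊ / 2) ^ 2 : NNReal) : ℝ)
    simp
    field_simp
    norm_num

/-- Hoeffding's inequality for the average, over a finite family of `[0, 1]`-valued functions, of
the absolute deviations of their empirical means. -/
lemma measure_sum_abs_deviation_ge_le {α κ : Type*} [MeasurableSpace α] {P : Measure α}
    [IsProbabilityMeasure P] {M : ℕ} (hM : 0 < M) {s : Finset κ} (hs : s.Nonempty)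
    {f : κ → α → ℝ} (hf : ∀ k, Measurable (f k)) (hf01 : ∀ k a, f k a ∈ Set.Icc (0 : ℝ) 1)
    {η : ℝ} (hη : 0 ≤ η) :
    (Measure.pi fun _ : Fin M => P).real
      {ω | η * s.card ≤ ∑ k ∈ s, |(∑ i, f k (ω i)) / M - ∫ a, f k a ∂P|}
      ≤ 2 * Real.exp (-(2 * M * η ^ 2)) := by
  set Q := Measure.pi fun _ : Fin M => P
  set D : κ → (Fin M → α) → ℝ := fun k ω => (∑ i, f k (ω i)) / M - ∫ a, f k a ∂P with hD
  have hsub : ∀ k, HasSubgaussianMGF (D k) (1 / (4 * M)) Q := fun k =>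
    hasSubgaussianMGF_mean_sub_integral hM (hf k) (hf01 k)
  have hM' : (0 : ℝ) < M := by exact_mod_cast hM
  have hc : (0 : ℝ) < s.card := by exact_mod_cast hs.card_pos
  -- Minimizer of the Chernoff exponent `t ^ 2 / (8 * M) - t * η`.
  set t : ℝ := 4 * M * η with ht
  have ht0 : 0 ≤ t := by positivity
  set X : (Fin M → α) → ℝ := fun ω =>
    (s.card : ℝ)⁻¹ * ∑ k ∈ s, (Real.exp (t * D k ω) + Real.exp (-t * D k ω))
  have hEi : ∀ k, Integrable (fun ω => Real.exp (t * D k ω) + Real.exp (-t * D k ω)) Q := fun k =>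
    ((hsub k).integrable_exp_mul t).add ((hsub k).integrable_exp_mul (-t))
  have hXi : Integrable X Q := by
    exact (integrable_finsetSum _ fun k _ => hEi k).const_mul _
  have hXle : ∫ ω, X ω ∂Q ≤ 2 * Real.exp (2 * M * η ^ 2) := by
    rw [integral_const_mul, integral_finsetSum _ fun k _ => hEi k]
    have : ∀ k ∈ s, ∫ ω, (Real.exp (t * D k ω) + Real.exp (-t * D k ω)) ∂Q
        ≤ 2 * Real.exp (2 * M * η ^ 2) := by
      intro k _
      rw [integral_add ((hsub k).integrable_exp_mul t) ((hsub k).integrable_exp_mul (-t))]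
      have h1 := (hsub k).mgf_le t
      have h2 := (hsub k).mgf_le (-t)
      have e : ((1 / (4 * M) : NNReal) : ℝ) * t ^ 2 / 2 = 2 * M * η ^ 2 := by
        push_cast
        rw [ht]
        field_simp
        ring
      rw [neg_sq, e] at h2
      rw [e] at h1
      simp only [mgf] at h1 h2
      linarith
    calc _ ≤ (s.card : ℝ)⁻¹ * ∑ k ∈ s, 2 * Real.exp (2 * M * η ^ 2) := by
          gcongr with k hk
          exact this k hk
      _ = _ := by
          rw [Finset.sum_const, nsmul_eq_mul]
          field_simp
  have hX0 : 0 ≤ᵐ[Q] X := .of_forall fun ω => by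
    simp only [X, Pi.zero_apply]
    positivity
  have hmk := mul_meas_ge_le_integral_of_nonneg hX0 hXi (Real.exp (t * η))
  have hsubset : {ω | η * s.card ≤ ∑ k ∈ s, |D k ω|} ⊆ {ω | Real.exp (t * η) ≤ X ω} := by
    intro ω hω
    simp only [Set.mem_ofPred_eq] at hω ⊢
    -- Jensen moves the exponential inside the average over `s`, so the final bound does not depend
    -- on the size of `s`.
    have hj := convexOn_exp.map_sum_le (t := s) (w := fun _ => (s.card : ℝ)⁻¹)
      (p := fun k => t * |D k ω|) (fun _ _ => by positivity)
      (by rw [Finset.sum_const, nsmul_eq_mul]; field_simp) (fun _ _ => Set.mem_univ _)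
    simp only [smul_eq_mul, ← Finset.mul_sum] at hj
    have h1 : t * η ≤ (s.card : ℝ)⁻¹ * (t * ∑ k ∈ s, |D k ω|) := by
      rw [inv_mul_eq_div, le_div_iff₀ hc, mul_assoc]
      exact mul_le_mul_of_nonneg_left hω ht0
    refine (Real.exp_le_exp.2 h1).trans (hj.trans ?_)
    simp only [X]
    gcongr with k _
    rcases abs_choice (D k ω) with h | h <;> rw [h]
    · linarith [Real.exp_pos (-t * D k ω)]
    · rw [mul_neg, ← neg_mul]
      linarith [Real.exp_pos (t * D k ω)]
  have h3 : Q.real {ω | η * s.card ≤ ∑ k ∈ s, |D k ω|} ≤ Q.real {ω | Real.exp (t * η) ≤ X ω} :=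
    measureReal_mono hsubset
  refine h3.trans ?_
  have h4 : Real.exp (t * η) * Q.real {ω | Real.exp (t * η) ≤ X ω} ≤
      2 * Real.exp (2 * M * η ^ 2) := hmk.trans hXle
  rw [mul_comm, ← le_div_iff₀ (Real.exp_pos _), mul_div_assoc, ← Real.exp_sub] at h4
  convert h4 using 3
  rw [ht]
  ring

lemma measure_abs_mean_sub_integral_ge_le {α : Type*} [MeasurableSpace α] {P : Measure α}
    [IsProbabilityMeasure P] {m : ℕ} (hm : 0 < m) {B : ℝ} (hB : 0 < B)
    {f : α → ℝ} (hf : Measurable f) (hfB : ∀ a, f a ∈ Set.Icc 0 B) {η : ℝ} (hη : 0 ≤ η) :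
    (Measure.pi fun _ : Fin m => P).real {ω | η ≤ |(∑ i, f (ω i)) / m - ∫ a, f a ∂P|}
      ≤ 2 * Real.exp (-(2 * m * (η / B) ^ 2)) := by
  have h := measure_sum_abs_deviation_ge_le (P := P) hm (s := {()}) (by simp)
    (f := fun _ a => f a / B) (fun _ => hf.div_const _)
    (fun _ a => ⟨div_nonneg (hfB a).1 hB.le, (div_le_one hB).2 (hfB a).2⟩)
    (η := η / B) (by positivity)
  refine le_of_eq_of_le ?_ h
  congr 1
  ext ω
  simp only [Set.mem_ofPred_eq, Finset.card_singleton, Nat.cast_one, mul_one, Finset.sum_singleton]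
  rw [integral_div, ← Finset.sum_div, div_right_comm, ← sub_div, abs_div, abs_of_pos hB,
    div_le_div_iff_of_pos_right hB]

/-! ### The discretized kernel and its bias. -/

namespace InvFeatures

variable {d : ℕ} {G : Type*} [Group G]

lemma below_reject_iff (ρ : G →* (E d ≃ₗᵢ[ℝ] E d)) (x : E d) (g : G) (ε : ℝ) (v : E d) (τ : ℝ) :
    Below ρ x g (reject ε v) τ ↔ ‖v‖ ^ 2 < 1 + ε ∧ inner ℝ x (ρ g v) ≤ τ := by
  unfold Below reject
  split_ifs with h <;> simp [h]

lemma abs_inner_action_le (ρ : G →* (E d ≃ₗᵢ[ℝ] E d)) {x : E d} (hx : ‖x‖ = 1) {ε : ℝ} (hε : 0 < ε)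
    {v : E d} (hv : ‖v‖ ^ 2 < 1 + ε) (g : G) : |(inner ℝ x (ρ g v) : ℝ)| ≤ 1 + ε := by
  refine (abs_real_inner_le_norm _ _).trans ?_
  rw [hx, one_mul, LinearIsometryEquiv.norm_map]
  nlinarith [norm_nonneg v]

lemma inner_action_eq (ρ : G →* (E d ≃ₗᵢ[ℝ] E d)) (x v : E d) (g : G) :
    (inner ℝ x (ρ g v) : ℝ) = inner ℝ (ρ g⁻¹ x) v := by
  rw [← LinearIsometryEquiv.inner_map_map (ρ g) (ρ g⁻¹ x) v]
  congr 1
  have : (ρ g * ρ g⁻¹) x = x := by rw [← map_mul]; simp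
  exact this.symm

variable [MeasurableSpace G]

lemma psi_mem_Icc (ρ : G →* (E d ≃ₗᵢ[ℝ] E d)) (μ : Measure G) [IsProbabilityMeasure μ]
    (x : E d) (t : Option (E d)) (τ : ℝ) : psi ρ μ x t τ ∈ Set.Icc (0 : ℝ) 1 :=
  ⟨measureReal_nonneg, measureReal_le_one⟩

lemma psi_reject_of_lt (ρ : G →* (E d ≃ₗᵢ[ℝ] E d)) (μ : Measure G) (x : E d) {ε : ℝ} {v : E d}
    (hv : ‖v‖ ^ 2 < 1 + ε) (τ : ℝ) :
    psi ρ μ x (reject ε v) τ = μ.real {g | inner ℝ x (ρ g v) ≤ τ} := by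
  simp [psi, below_reject_iff, hv]

lemma psi_reject_of_not_lt (ρ : G →* (E d ≃ₗᵢ[ℝ] E d)) (μ : Measure G) (x : E d) {ε : ℝ} {v : E d}
    (hv : ¬ ‖v‖ ^ 2 < 1 + ε) (τ : ℝ) :
    psi ρ μ x (reject ε v) τ = 0 := by
  simp [psi, below_reject_iff, hv]

/-- The Riemann sum, over the bins `-n, …, n`, of the inner integral of the kernel. -/
def riemannKernel (ρ : G →* (E d ≃ₗᵢ[ℝ] E d)) (μ : Measure G) (ε : ℝ) (n : ℕ) (x z v : E d) : ℝ :=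
  (1 + ε) / n * ∑ k ∈ Finset.Icc (-(n : ℤ)) n,
    psi ρ μ x (reject ε v) ((1 + ε) / n * k) * psi ρ μ z (reject ε v) ((1 + ε) / n * k)

lemma mesh_mul_card_le {ε : ℝ} (hε0 : 0 < ε) (hε1 : ε < 1) {n : ℕ} (hn : 0 < n) :
    (1 + ε) / n * ((Finset.Icc (-(n : ℤ)) n).card : ℝ) ≤ 6 := by
  have hn' : (1 : ℝ) ≤ n := by exact_mod_cast hn
  rw [Int.card_Icc, show ((n : ℤ) + 1 - -(n : ℤ)).toNat = 2 * n + 1 by omega, div_mul_eq_mul_div,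
    div_le_iff₀ (by linarith)]
  push_cast
  nlinarith

lemma riemannKernel_mem_Icc (ρ : G →* (E d ≃ₗᵢ[ℝ] E d)) (μ : Measure G) [IsProbabilityMeasure μ]
    {ε : ℝ} (hε0 : 0 < ε) (hε1 : ε < 1) {n : ℕ} (hn : 0 < n) (x z v : E d) :
    riemannKernel ρ μ ε n x z v ∈ Set.Icc (0 : ℝ) 6 := by
  refine ⟨mul_nonneg (by positivity) (Finset.sum_nonneg fun k _ =>
    mul_nonneg (psi_mem_Icc ρ μ _ _ _).1 (psi_mem_Icc ρ μ _ _ _).1), ?_⟩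
  refine le_trans ?_ (mesh_mul_card_le hε0 hε1 hn)
  refine mul_le_mul_of_nonneg_left ?_ (by positivity)
  refine (Finset.sum_le_card_nsmul _ _ 1 fun k _ => ?_).trans (by simp)
  exact mul_le_one₀ (psi_mem_Icc ρ μ _ _ _).2 (psi_mem_Icc ρ μ _ _ _).1 (psi_mem_Icc ρ μ _ _ _).2

variable [TopologicalSpace G] [BorelSpace G]

lemma measurable_inner_action {ρ : G →* (E d ≃ₗᵢ[ℝ] E d)} (hρ : ∀ v, Continuous fun g => ρ g v)
    (x : E d) : Measurable fun p : G × E d => (inner ℝ x (ρ p.1 p.2) : ℝ) := by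
  -- Expanding in a basis separates the variables, so strong continuity in `g` suffices for joint
  -- measurability.
  have h : ∀ p : G × E d, (inner ℝ x (ρ p.1 p.2) : ℝ) =
      ∑ i, p.2 i * inner ℝ x (ρ p.1 (EuclideanSpace.basisFun (Fin d) ℝ i)) := by
    intro p
    conv_lhs => rw [← (EuclideanSpace.basisFun (Fin d) ℝ).sum_repr p.2]
    simp [map_sum, inner_sum, real_inner_smul_right]
  simp_rw [h]
  refine Finset.measurable_fun_sum _ fun i _ => Measurable.mul (by fun_prop) ?_
  have : Measurable fun g : G => (inner ℝ x (ρ g (EuclideanSpace.basisFun (Fin d) ℝ i)) : ℝ) :=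
    (continuous_const.inner (hρ _)).measurable
  exact this.comp measurable_fst

lemma measurable_inner_action_comp {ρ : G →* (E d ≃ₗᵢ[ℝ] E d)} (hρ : ∀ v, Continuous fun g => ρ g v)
    {β : Type*} [MeasurableSpace β] {a : β → G} {w : β → E d} (ha : Measurable a)
    (hw : Measurable w) (x : E d) : Measurable fun b => (inner ℝ x (ρ (a b) (w b)) : ℝ) := by
  have h := (measurable_inner_action hρ x).comp (ha.prodMk hw)
  simpa only [Function.comp_def] using h

lemma measurableSet_below_reject {ρ : G →* (E d ≃ₗᵢ[ℝ] E d)}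
    (hρ : ∀ v, Continuous fun g => ρ g v) (x : E d) (ε τ : ℝ) :
    MeasurableSet {p : G × E d | Below ρ x p.1 (reject ε p.2) τ} := by
  simp_rw [below_reject_iff]
  have h : MeasurableSet {p : G × E d | ‖p.2‖ ^ 2 < 1 + ε} :=
    measurableSet_lt (by fun_prop) measurable_const
  exact h.inter (measurableSet_le (measurable_inner_action hρ x) measurable_const)

lemma measurable_inner_action_left {ρ : G →* (E d ≃ₗᵢ[ℝ] E d)}
    (hρ : ∀ v, Continuous fun g => ρ g v) (x v : E d) :
    Measurable fun g : G => (inner ℝ x (ρ g v) : ℝ) :=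
  (continuous_const.inner (hρ v)).measurable

lemma measurable_psi_reject {ρ : G →* (E d ≃ₗᵢ[ℝ] E d)} (hρ : ∀ v, Continuous fun g => ρ g v)
    (μ : Measure G) [IsProbabilityMeasure μ] (x : E d) (ε τ : ℝ) :
    Measurable fun v => psi ρ μ x (reject ε v) τ :=
  (measurable_measure_prodMk_right (measurableSet_below_reject hρ x ε τ)).ennreal_toReal

lemma measurable_riemannKernel {ρ : G →* (E d ≃ₗᵢ[ℝ] E d)} (hρ : ∀ v, Continuous fun g => ρ g v)
    (μ : Measure G) [IsProbabilityMeasure μ] (ε : ℝ) (n : ℕ) (x z : E d) :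
    Measurable (riemannKernel ρ μ ε n x z) := by
  refine Measurable.const_mul (Finset.measurable_fun_sum _ fun k _ => ?_) _
  exact (measurable_psi_reject hρ μ x ε _).mul (measurable_psi_reject hρ μ z ε _)

/-- The discretization error of the kernel is at most half a mesh width. -/
lemma abs_integral_riemannKernel_sub_kernel_le {ρ : G →* (E d ≃ₗᵢ[ℝ] E d)}
    (hρ : ∀ v, Continuous fun g => ρ g v) (μ : Measure G) [IsProbabilityMeasure μ]
    {ε : ℝ} (hε0 : 0 < ε) (hε1 : ε < 1) {n : ℕ} (hn : 0 < n) {x z : E d}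
    (hx : ‖x‖ = 1) (hz : ‖z‖ = 1) :
    |∫ v, riemannKernel ρ μ ε n x z v ∂(gaussianVec d) - kernel ρ μ ε x z| ≤
      (1 + ε) / n * (1 / 2) := by
  set h : ℝ := (1 + ε) / n with hh
  have hn' : (0 : ℝ) < n := by exact_mod_cast hn
  have hh0 : 0 < h := by positivity
  have hhn : h * n = 1 + ε := by rw [hh]; field_simp
  -- Discretization error of an accepted template `v`, before averaging over the pair of group
  -- elements.
  set b : E d → G × G → ℝ := fun v p =>
    h * (1 - Int.fract (-(max (inner ℝ x (ρ p.1 v)) (inner ℝ z (ρ p.2 v)) / h))) with hb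
  have hb0 : ∀ v p, 0 ≤ b v p := fun v p =>
    mul_nonneg hh0.le (sub_nonneg.2 (Int.fract_lt_one _).le)
  have hb1 : ∀ v p, b v p ≤ h := fun v p =>
    mul_le_of_le_one_right hh0.le (sub_le_self _ (Int.fract_nonneg _))
  have hbm : Measurable (Function.uncurry b) := by
    have h1 := measurable_inner_action_comp hρ (β := E d × (G × G)) (measurable_fst.comp measurable_snd)
      measurable_fst x
    have h2 := measurable_inner_action_comp hρ (β := E d × (G × G)) (measurable_snd.comp measurable_snd)
      measurable_fst z
    exact (((h1.max h2).div_const h).neg.fract.const_sub 1).const_mul h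
  have hbi : Integrable (Function.uncurry b) ((gaussianVec d).prod (μ.prod μ)) :=
    Integrable.of_mem_Icc 0 h hbm.aemeasurable (.of_forall fun q => ⟨hb0 _ _, hb1 _ _⟩)
  set B : E d → ℝ := fun v => ∫ p, b v p ∂(μ.prod μ) with hB
  have hBi : Integrable B (gaussianVec d) := hbi.integral_prod_left
  have hB0 : ∀ v, 0 ≤ B v := fun v => integral_nonneg (hb0 v)
  set K : Set (E d) := {v | ‖v‖ ^ 2 < 1 + ε}
  have hK : MeasurableSet K := measurableSet_lt (by fun_prop) measurable_const
  have hRi : Integrable (riemannKernel ρ μ ε n x z) (gaussianVec d) :=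
    Integrable.of_mem_Icc 0 6 (measurable_riemannKernel hρ μ ε n x z).aemeasurable
      (.of_forall fun v => riemannKernel_mem_Icc ρ μ hε0 hε1 hn x z v)
  have hdiff : ∀ v, (∫ τ in (-(1 + ε))..(1 + ε),
      psi ρ μ x (reject ε v) τ * psi ρ μ z (reject ε v) τ) =
        riemannKernel ρ μ ε n x z v - K.indicator B v := by
    intro v
    by_cases hv : ‖v‖ ^ 2 < 1 + ε
    · rw [Set.indicator_of_mem (show v ∈ K from hv)]
      have := riemann_sub_integral_cdf_mul (μ := μ) (measurable_inner_action_left hρ x v)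
        (measurable_inner_action_left hρ z v) (n := n) hh0
        (by rw [hhn]; exact abs_inner_action_le ρ hx hε0 hv)
        (by rw [hhn]; exact abs_inner_action_le ρ hz hε0 hv)
      rw [hhn] at this
      simp only [hB, hb, riemannKernel, psi_reject_of_lt ρ μ _ hv]
      rw [← this]
      ring
    · rw [Set.indicator_of_notMem (show v ∉ K from hv)]
      simp [riemannKernel, psi_reject_of_not_lt ρ μ _ hv]
  have hker : kernel ρ μ ε x z = ∫ v, riemannKernel ρ μ ε n x z v ∂(gaussianVec d) -
      ∫ v, K.indicator B v ∂(gaussianVec d) := by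
    rw [kernel, ← integral_sub hRi (hBi.indicator hK)]
    exact integral_congr_ae (.of_forall hdiff)
  -- The error is nonnegative, so dropping the rejection only increases it and leaves a full
  -- Gaussian expectation.
  have hle : ∫ v, K.indicator B v ∂(gaussianVec d) ≤ ∫ v, B v ∂(gaussianVec d) :=
    integral_mono (hBi.indicator hK) hBi fun v => Set.indicator_le_self' (fun _ _ => hB0 _) v
  have hBle : ∫ v, B v ∂(gaussianVec d) ≤ h * (1 / 2) := by
    rw [hB, integral_integral_swap hbi]
    calc _ ≤ ∫ _p : G × G, h * (1 / 2) ∂(μ.prod μ) := by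
          refine integral_mono hbi.integral_prod_right (integrable_const _) fun p => ?_
          -- Orthogonality moves the action onto `x` and `z`, which stay unit vectors, so the
          -- Gaussian estimate holds for each fixed pair of group elements.
          simp only [hb, inner_action_eq]
          rw [integral_const_mul]
          refine mul_le_mul_of_nonneg_left ?_ hh0.le
          exact integral_one_sub_fract_neg_max_le (by rw [LinearIsometryEquiv.norm_map, hx])
            (by rw [LinearIsometryEquiv.norm_map, hz]) hh0
      _ = _ := by simp
  have hnn : 0 ≤ ∫ v, K.indicator B v ∂(gaussianVec d) :=
    integral_nonneg fun v => Set.indicator_nonneg (fun v _ => hB0 v) v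
  rw [hker, sub_sub_cancel, abs_of_nonneg hnn]
  exact hle.trans hBle

end InvFeatures

/-! ### Empirical features and their deviation from the discretized kernel. -/

namespace InvFeatures

variable {d : ℕ} {G : Type*} [Group G]

/-- The empirical version of `psi` for sampled group elements. -/
def empiricalPsi (ρ : G →* (E d ≃ₗᵢ[ℝ] E d)) {M : ℕ} (g : Fin M → G) (x : E d)
    (t : Option (E d)) (τ : ℝ) : ℝ :=
  (∑ i, {h | Below ρ x h t τ}.indicator (fun _ => (1 : ℝ)) (g i)) / M

lemma empiricalPsi_mem_Icc (ρ : G →* (E d ≃ₗᵢ[ℝ] E d)) {M : ℕ} (g : Fin M → G) (x : E d)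
    (t : Option (E d)) (τ : ℝ) : empiricalPsi ρ g x t τ ∈ Set.Icc (0 : ℝ) 1 := by
  refine ⟨div_nonneg (Finset.sum_nonneg fun i _ => Set.indicator_nonneg (by simp) _)
    (by positivity), div_le_one_of_le₀ ?_ (by positivity)⟩
  calc _ ≤ ∑ _i : Fin M, (1 : ℝ) :=
        Finset.sum_le_sum fun i _ => Set.indicator_le_self' (fun _ _ => zero_le_one) (g i)
    _ = M := by simp

lemma inner_Phi (ρ : G →* (E d ≃ₗᵢ[ℝ] E d)) {ε : ℝ} (hε : 0 < ε) (n : ℕ) {m M : ℕ}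
    (t : Fin m → Option (E d)) (g : Fin M → G) (x z : E d) :
    inner ℝ (Phi ρ ε n t g x) (Phi ρ ε n t g z) =
      (∑ l, (1 + ε) / n * ∑ k ∈ Finset.Icc (-(n : ℤ)) n,
        empiricalPsi ρ g x (t l) ((1 + ε) / n * k) *
          empiricalPsi ρ g z (t l) ((1 + ε) / n * k)) / m := by
  have hphi : ∀ (y : E d) (s : Option (E d)) (k : ℤ), phi ρ ε n m g y s k =
      Real.sqrt (1 + ε) / Real.sqrt (n * m) * empiricalPsi ρ g y s ((1 + ε) / n * k) := by
    intro y s k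
    classical
    simp only [phi, empiricalPsi, Set.indicator_apply, Set.mem_ofPred_eq]
    rw [← div_div, div_mul_eq_mul_div, mul_div_assoc]
  have hsq : ∀ a b : ℝ, Real.sqrt (1 + ε) / Real.sqrt (n * m) * a *
      (Real.sqrt (1 + ε) / Real.sqrt (n * m) * b) = (1 + ε) / n * (a * b) / m := by
    intro a b
    have h1 : Real.sqrt (1 + ε) * Real.sqrt (1 + ε) = 1 + ε := Real.mul_self_sqrt (by linarith)
    have h2 : Real.sqrt (n * m) * Real.sqrt (n * m) = n * m := Real.mul_self_sqrt (by positivity)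
    calc _ = (Real.sqrt (1 + ε) * Real.sqrt (1 + ε)) /
          (Real.sqrt (n * m) * Real.sqrt (n * m)) * (a * b) := by ring
      _ = _ := by rw [h1, h2]; ring
  simp only [Phi, PiLp.inner_apply, Fintype.sum_prod_type, hphi, RCLike.inner_apply, conj_trivial,
    hsq]
  rw [Finset.sum_div]
  refine Finset.sum_congr rfl fun l _ => ?_
  rw [Finset.sum_coe_sort (Finset.Icc (-(n : ℤ)) n) fun k =>
    (1 + ε) / n * (empiricalPsi ρ g z (t l) ((1 + ε) / n * k) *
      empiricalPsi ρ g x (t l) ((1 + ε) / n * k)) / (m : ℝ), ← Finset.sum_div, Finset.mul_sum]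
  simp_rw [mul_comm (empiricalPsi ρ g z _ _)]

lemma abs_mul_sub_mul_le {a b a' b' : ℝ} (ha : a ∈ Set.Icc (0 : ℝ) 1)
    (hb' : b' ∈ Set.Icc (0 : ℝ) 1) : |a * b - a' * b'| ≤ |a - a'| + |b - b'| := by
  calc |a * b - a' * b'| = |a * (b - b') + b' * (a - a')| := by congr 1; ring
    _ ≤ |a * (b - b')| + |b' * (a - a')| := abs_add_le _ _
    _ ≤ |b - b'| + |a - a'| := by
        rw [abs_mul, abs_mul, abs_of_nonneg ha.1, abs_of_nonneg hb'.1]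
        exact add_le_add (mul_le_of_le_one_left (abs_nonneg _) ha.2)
          (mul_le_of_le_one_left (abs_nonneg _) hb'.2)
    _ = _ := add_comm _ _

variable [MeasurableSpace G]

/-- The factor 12 is 2, from the two factors of each product, times 6, the bound on mesh times
number of bins. -/
lemma abs_inner_Phi_sub_le (ρ : G →* (E d ≃ₗᵢ[ℝ] E d)) (μ : Measure G) [IsProbabilityMeasure μ]
    {ε : ℝ} (hε0 : 0 < ε) (hε1 : ε < 1) {n : ℕ} (hn : 0 < n) {m M : ℕ} (hm : 0 < m)
    (v : Fin m → E d) (g : Fin M → G) (x z : E d) {η : ℝ}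
    (hx : ∀ l, ∑ k ∈ Finset.Icc (-(n : ℤ)) n,
      |empiricalPsi ρ g x (reject ε (v l)) ((1 + ε) / n * k)
        - psi ρ μ x (reject ε (v l)) ((1 + ε) / n * k)| ≤ η * (Finset.Icc (-(n : ℤ)) n).card)
    (hz : ∀ l, ∑ k ∈ Finset.Icc (-(n : ℤ)) n,
      |empiricalPsi ρ g z (reject ε (v l)) ((1 + ε) / n * k)
        - psi ρ μ z (reject ε (v l)) ((1 + ε) / n * k)| ≤ η * (Finset.Icc (-(n : ℤ)) n).card)
    (hη : 0 ≤ η) :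
    |inner ℝ (Phi ρ ε n (fun l => reject ε (v l)) g x) (Phi ρ ε n (fun l => reject ε (v l)) g z)
      - (∑ l, riemannKernel ρ μ ε n x z (v l)) / m| ≤ 12 * η := by
  have hm' : (0 : ℝ) < m := by exact_mod_cast hm
  rw [inner_Phi ρ hε0, ← sub_div, ← Finset.sum_sub_distrib, abs_div, abs_of_pos hm',
    div_le_iff₀ hm']
  refine (Finset.abs_sum_le_sum_abs _ _).trans ?_
  have hl : ∀ l ∈ Finset.univ, |(1 + ε) / n * ∑ k ∈ Finset.Icc (-(n : ℤ)) n,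
        empiricalPsi ρ g x (reject ε (v l)) ((1 + ε) / n * k) *
          empiricalPsi ρ g z (reject ε (v l)) ((1 + ε) / n * k)
        - riemannKernel ρ μ ε n x z (v l)| ≤ 12 * η := by
    intro l _
    have hh : 0 ≤ (1 + ε) / n := by positivity
    rw [riemannKernel, ← mul_sub, ← Finset.sum_sub_distrib, abs_mul, abs_of_nonneg hh]
    have h1 : |∑ k ∈ Finset.Icc (-(n : ℤ)) n,
        (empiricalPsi ρ g x (reject ε (v l)) ((1 + ε) / n * k) *
          empiricalPsi ρ g z (reject ε (v l)) ((1 + ε) / n * k)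
          - psi ρ μ x (reject ε (v l)) ((1 + ε) / n * k) *
            psi ρ μ z (reject ε (v l)) ((1 + ε) / n * k))|
        ≤ 2 * η * (Finset.Icc (-(n : ℤ)) n).card := by
      refine (Finset.abs_sum_le_sum_abs _ _).trans ?_
      refine (Finset.sum_le_sum fun k _ => abs_mul_sub_mul_le (empiricalPsi_mem_Icc ρ g _ _ _)
        (psi_mem_Icc ρ μ _ _ _)).trans ?_
      rw [Finset.sum_add_distrib]
      linarith [hx l, hz l]
    calc _ ≤ (1 + ε) / n * (2 * η * (Finset.Icc (-(n : ℤ)) n).card) :=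
          mul_le_mul_of_nonneg_left h1 hh
      _ = 2 * η * ((1 + ε) / n * (Finset.Icc (-(n : ℤ)) n).card) := by ring
      _ ≤ 2 * η * 6 := mul_le_mul_of_nonneg_left (mesh_mul_card_le hε0 hε1 hn) (by positivity)
      _ = 12 * η := by ring
  refine (Finset.sum_le_sum hl).trans (le_of_eq ?_)
  simp [mul_comm]

variable [TopologicalSpace G] [BorelSpace G]

lemma measure_psi_deviation_le {ρ : G →* (E d ≃ₗᵢ[ℝ] E d)} (hρ : ∀ v, Continuous fun g => ρ g v)
    (μ : Measure G) [IsProbabilityMeasure μ] (ε : ℝ) (n : ℕ) {M : ℕ} (hM : 0 < M)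
    (x v : E d) {η : ℝ} (hη : 0 ≤ η) :
    (Measure.pi fun _ : Fin M => μ).real {g | η * (Finset.Icc (-(n : ℤ)) n).card ≤
      ∑ k ∈ Finset.Icc (-(n : ℤ)) n, |empiricalPsi ρ g x (reject ε v) ((1 + ε) / n * k)
        - psi ρ μ x (reject ε v) ((1 + ε) / n * k)|} ≤ 2 * Real.exp (-(2 * M * η ^ 2)) := by
  have hms : ∀ τ, MeasurableSet {h | Below ρ x h (reject ε v) τ} := fun τ =>
    measurable_prodMk_right (measurableSet_below_reject hρ x ε τ)
  have h := measure_sum_abs_deviation_ge_le (P := μ) hM (s := Finset.Icc (-(n : ℤ)) n)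
    ⟨0, by simp⟩ (f := fun (k : ℤ) => {h | Below ρ x h (reject ε v) ((1 + ε) / n * k)}.indicator
      (fun _ => (1 : ℝ))) (fun k => measurable_const.indicator (hms _))
    (fun k a => ⟨Set.indicator_nonneg (by simp) _, Set.indicator_le_self' (by simp) _⟩) hη
  simp_rw [integral_indicator_const _ (hms _)] at h
  simpa [empiricalPsi, psi] using h

lemma measurable_empiricalPsi {ρ : G →* (E d ≃ₗᵢ[ℝ] E d)} (hρ : ∀ v, Continuous fun g => ρ g v)
    (ε : ℝ) {m M : ℕ} (x : E d) (l : Fin m) (τ : ℝ) :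
    Measurable fun ω : (Fin m → E d) × (Fin M → G) =>
      empiricalPsi ρ ω.2 x (reject ε (ω.1 l)) τ := by
  refine (Finset.measurable_fun_sum _ fun i _ => ?_).div_const _
  have h : Measurable ({p : G × E d | Below ρ x p.1 (reject ε p.2) τ}.indicator
      fun _ => (1 : ℝ)) := measurable_const.indicator (measurableSet_below_reject hρ x ε τ)
  have hp : Measurable fun ω : (Fin m → E d) × (Fin M → G) => (ω.2 i, ω.1 l) := by fun_prop
  have hc := h.comp hp
  classical
  simpa only [Function.comp_def, Set.indicator_apply, Set.mem_ofPred_eq] using hc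

/-- All templates share the same group samples; with the templates frozen the bound is uniform, and
Fubini integrates it. -/
lemma measure_psi_deviation_joint_le {ρ : G →* (E d ≃ₗᵢ[ℝ] E d)}
    (hρ : ∀ v, Continuous fun g => ρ g v) (μ : Measure G) [IsProbabilityMeasure μ] (ε : ℝ) (n : ℕ)
    {m M : ℕ} (hM : 0 < M) (x : E d) (l : Fin m) {η : ℝ} (hη : 0 ≤ η) :
    (sampleLaw d μ m M).real {ω | η * (Finset.Icc (-(n : ℤ)) n).card ≤
      ∑ k ∈ Finset.Icc (-(n : ℤ)) n,
        |empiricalPsi ρ ω.2 x (reject ε (ω.1 l)) ((1 + ε) / n * k)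
          - psi ρ μ x (reject ε (ω.1 l)) ((1 + ε) / n * k)|} ≤
        2 * Real.exp (-(2 * M * η ^ 2)) := by
  have hmeas : MeasurableSet {ω : (Fin m → E d) × (Fin M → G) |
      η * (Finset.Icc (-(n : ℤ)) n).card ≤ ∑ k ∈ Finset.Icc (-(n : ℤ)) n,
        |empiricalPsi ρ ω.2 x (reject ε (ω.1 l)) ((1 + ε) / n * k)
          - psi ρ μ x (reject ε (ω.1 l)) ((1 + ε) / n * k)|} := by
    refine measurableSet_le measurable_const (Finset.measurable_fun_sum _ fun k _ => ?_)
    refine Measurable.abs ((measurable_empiricalPsi hρ ε x l _).sub ?_)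
    exact (measurable_psi_reject hρ μ x ε _).comp (by fun_prop :
      Measurable fun ω : (Fin m → E d) × (Fin M → G) => ω.1 l)
  refine ENNReal.toReal_le_of_le_ofReal (by positivity) ?_
  rw [sampleLaw, Measure.prod_apply hmeas]
  calc _ ≤ ∫⁻ _v : Fin m → E d, ENNReal.ofReal (2 * Real.exp (-(2 * M * η ^ 2)))
        ∂(Measure.pi fun _ : Fin m => gaussianVec d) := by
        refine lintegral_mono fun v => ?_
        rw [ENNReal.le_ofReal_iff_toReal_le (measure_ne_top _ _) (by positivity)]
        exact measure_psi_deviation_le hρ μ ε n hM x (v l) hη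
    _ = _ := by simp

lemma measure_riemannKernel_deviation_le {ρ : G →* (E d ≃ₗᵢ[ℝ] E d)}
    (hρ : ∀ v, Continuous fun g => ρ g v) (μ : Measure G) [IsProbabilityMeasure μ]
    {ε : ℝ} (hε0 : 0 < ε) (hε1 : ε < 1) {n : ℕ} (hn : 0 < n) {m : ℕ} (M : ℕ) (hm : 0 < m)
    (x z : E d) {η : ℝ} (hη : 0 ≤ η) :
    (sampleLaw d μ m M).real {ω | η ≤ |(∑ l, riemannKernel ρ μ ε n x z (ω.1 l)) / m
      - ∫ v, riemannKernel ρ μ ε n x z v ∂(gaussianVec d)|} ≤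
        2 * Real.exp (-(2 * m * (η / 6) ^ 2)) := by
  have h := measure_abs_mean_sub_integral_ge_le (P := gaussianVec d) hm (B := 6) (by norm_num)
    (measurable_riemannKernel hρ μ ε n x z)
    (fun v => riemannKernel_mem_Icc ρ μ hε0 hε1 hn x z v) hη
  refine le_of_eq_of_le ?_ h
  rw [sampleLaw, ← mul_one (Measure.real (Measure.pi _) _),
    ← probReal_univ (μ := Measure.pi fun _ : Fin M => μ), ← measureReal_prod_prod]
  congr 1
  ext ω
  simp

lemma exp_neg_mul_log_le {c A p : ℝ} {a : ℕ} (hA : 0 < A) (h : a * Real.log (A / p) ≤ c)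
    (hp : 0 < p) : Real.exp (-c) ≤ (p / A) ^ a := by
  calc Real.exp (-c) ≤ Real.exp (a * Real.log (p / A)) := by
        rw [Real.exp_le_exp, ← inv_div A p, Real.log_inv]
        linarith
    _ = _ := by rw [Real.exp_nat_mul, Real.exp_log (by positivity)]

end InvFeatures

end

/-! ### Union bound and choice of constants. -/

open InvFeatures in
theorem theorem2 :
    ∃ C₁ : ℝ, 0 < C₁ ∧ ∃ C₂ : ℝ, 0 < C₂ ∧
      ∀ (d : ℕ) (G : Type*) [Group G] [TopologicalSpace G] [IsTopologicalGroup G] [CompactSpace G]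
        [MeasurableSpace G] [BorelSpace G]
        (μ : MeasureTheory.Measure G) [μ.IsHaarMeasure] [MeasureTheory.IsProbabilityMeasure μ]
        (ρ : G →* (InvFeatures.E d ≃ₗᵢ[ℝ] InvFeatures.E d)),
        (∀ v, Continuous fun g => ρ g v) →
      ∀ (ε : ℝ), 0 < ε → ε < 1 →
      ∀ (N : ℕ), 2 ≤ N →
      ∀ (x : Fin N → InvFeatures.E d), (∀ i, ‖x i‖ = 1) →
      ∀ (ε₀ ε₁ ε₂ δ₁ δ₂ : ℝ), ε₀ ∈ Set.Ioo (0 : ℝ) 1 → ε₁ ∈ Set.Ioo (0 : ℝ) 1 →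
        ε₂ ∈ Set.Ioo (0 : ℝ) 1 → δ₁ ∈ Set.Ioo (0 : ℝ) 1 → δ₂ ∈ Set.Ioo (0 : ℝ) 1 →
      ∀ (n m M : ℕ), 1 / ε₀ ≤ (n : ℝ) →
        C₁ / ε₁ ^ 2 * Real.log ((N : ℝ) / δ₁) ≤ (m : ℝ) →
        C₂ / ε₂ ^ 2 * Real.log ((N : ℝ) * m / δ₂) ≤ (M : ℝ) →
      1 - δ₁ - δ₂ ≤ (InvFeatures.sampleLaw d μ m M).real
        {ω | ∀ i j : Fin N,
          |inner ℝ (InvFeatures.Phi ρ ε n (fun l => InvFeatures.reject ε (ω.1 l)) ω.2 (x i))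
              (InvFeatures.Phi ρ ε n (fun l => InvFeatures.reject ε (ω.1 l)) ω.2 (x j))
            - InvFeatures.kernel ρ μ ε (x i) (x j)| ≤ ε₀ + ε₁ + ε₂} := by
  -- `54 = 3 * 18` and `144 = 2 * 72` turn the exponents `m ε₁² / 18` and `M ε₂² / 72` into 3 and 2
  -- times the logarithms.
  refine ⟨54, by norm_num, 144, by norm_num, ?_⟩
  intro d G _ _ _ _ _ _ μ _ _ ρ hρ ε hε0 hε1 N hN x hx ε₀ ε₁ ε₂ δ₁ δ₂ hε₀ hε₁ hε₂ hδ₁ hδ₂ n m M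
    hn hm hM
  obtain ⟨hε₀, -⟩ := hε₀
  obtain ⟨hε₁, -⟩ := hε₁
  obtain ⟨hε₂, -⟩ := hε₂
  obtain ⟨hδ₁, hδ₁'⟩ := hδ₁
  obtain ⟨hδ₂, hδ₂'⟩ := hδ₂
  have hN' : (2 : ℝ) ≤ N := by exact_mod_cast hN
  have hnR : (0 : ℝ) < n := lt_of_lt_of_le (by positivity) hn
  have hn0 : 0 < n := by exact_mod_cast hnR
  have hlog1 : 0 < Real.log ((N : ℝ) / δ₁) :=
    Real.log_pos (by rw [lt_div_iff₀ hδ₁]; linarith)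
  have hmR : (0 : ℝ) < m := lt_of_lt_of_le (by positivity) hm
  have hm0 : 0 < m := by exact_mod_cast hmR
  have hm1 : (1 : ℝ) ≤ m := by exact_mod_cast hm0
  have hNm : 2 ≤ (N : ℝ) * m := by nlinarith
  have hlog2 : 0 < Real.log ((N : ℝ) * m / δ₂) :=
    Real.log_pos (by rw [lt_div_iff₀ hδ₂]; linarith)
  have hMR : (0 : ℝ) < M := lt_of_lt_of_le (by positivity) hM
  have hM0 : 0 < M := by exact_mod_cast hMR
  have hprob : IsProbabilityMeasure (sampleLaw d μ m M) := by unfold sampleLaw; infer_instance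
  set Q := sampleLaw d μ m M
  set bad₁ : Fin N × Fin N → Set ((Fin m → E d) × (Fin M → G)) := fun q =>
    {ω | ε₁ ≤ |(∑ l, riemannKernel ρ μ ε n (x q.1) (x q.2) (ω.1 l)) / m
      - ∫ v, riemannKernel ρ μ ε n (x q.1) (x q.2) v ∂(gaussianVec d)|} with hbad₁
  set bad₂ : Fin N × Fin m → Set ((Fin m → E d) × (Fin M → G)) := fun q =>
    {ω | ε₂ / 12 * (Finset.Icc (-(n : ℤ)) n).card ≤ ∑ k ∈ Finset.Icc (-(n : ℤ)) n,
        |empiricalPsi ρ ω.2 (x q.1) (reject ε (ω.1 q.2)) ((1 + ε) / n * k)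
          - psi ρ μ (x q.1) (reject ε (ω.1 q.2)) ((1 + ε) / n * k)|} with hbad₂
  have hb₁ : Q.real (⋃ q, bad₁ q) ≤ δ₁ := by
    -- Cube rather than square: the union runs over `N ^ 2` pairs, and the spare factor `1 / N`
    -- absorbs the 2 from the two tails.
    have hexp : Real.exp (-(2 * m * (ε₁ / 6) ^ 2)) ≤ (δ₁ / N) ^ 3 := by
      refine exp_neg_mul_log_le (by linarith) ?_ hδ₁
      rw [div_mul_eq_mul_div, div_le_iff₀ (by positivity)] at hm
      push_cast
      linarith
    calc _ ≤ ∑ q, Q.real (bad₁ q) := measureReal_iUnion_fintype_le _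
      _ ≤ ∑ _q : Fin N × Fin N, 2 * (δ₁ / N) ^ 3 := Finset.sum_le_sum fun q _ =>
          (measure_riemannKernel_deviation_le hρ μ hε0 hε1 hn0 M hm0 (x q.1) (x q.2) hε₁.le).trans
            (by linarith)
      _ = δ₁ * (2 * δ₁ ^ 2 / N) := by
          simp
          field_simp
      _ ≤ δ₁ * 1 := by
          refine mul_le_mul_of_nonneg_left ?_ hδ₁.le
          rw [div_le_one (by linarith)]
          nlinarith
      _ = δ₁ := mul_one _
  have hb₂ : Q.real (⋃ q, bad₂ q) ≤ δ₂ := by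
    -- Only `N * m` events here, one per point and template, so a square suffices.
    have hexp : Real.exp (-(2 * M * (ε₂ / 12) ^ 2)) ≤ (δ₂ / (N * m)) ^ 2 := by
      refine exp_neg_mul_log_le (by linarith) ?_ hδ₂
      rw [div_mul_eq_mul_div, div_le_iff₀ (by positivity)] at hM
      push_cast
      linarith
    calc _ ≤ ∑ q, Q.real (bad₂ q) := measureReal_iUnion_fintype_le _
      _ ≤ ∑ _q : Fin N × Fin m, 2 * (δ₂ / (N * m)) ^ 2 := Finset.sum_le_sum fun q _ =>
          (measure_psi_deviation_joint_le hρ μ ε n hM0 (x q.1) q.2 (by positivity)).trans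
            (by linarith)
      _ = δ₂ * (2 * δ₂ / (N * m)) := by
          simp
          field_simp
      _ ≤ δ₂ * 1 := by
          refine mul_le_mul_of_nonneg_left ?_ hδ₂.le
          rw [div_le_one (by linarith)]
          nlinarith
      _ = δ₂ := mul_one _
  set good := {ω : (Fin m → E d) × (Fin M → G) | ∀ i j : Fin N,
    |inner ℝ (Phi ρ ε n (fun l => reject ε (ω.1 l)) ω.2 (x i))
        (Phi ρ ε n (fun l => reject ε (ω.1 l)) ω.2 (x j))
      - kernel ρ μ ε (x i) (x j)| ≤ ε₀ + ε₁ + ε₂}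
  -- Covering the whole space and using subadditivity makes measurability of `good` unnecessary.
  have hcover : Set.univ ⊆ good ∪ ((⋃ q, bad₁ q) ∪ ⋃ q, bad₂ q) := by
    intro ω _
    by_cases h1 : ω ∈ ⋃ q, bad₁ q
    · exact Or.inr (Or.inl h1)
    by_cases h2 : ω ∈ ⋃ q, bad₂ q
    · exact Or.inr (Or.inr h2)
    left
    intro i j
    simp only [hbad₁, hbad₂, Set.mem_iUnion, Set.mem_ofPred_eq, not_exists, not_le] at h1 h2
    have e1 := h1 (i, j)
    have e2 := abs_inner_Phi_sub_le ρ μ hε0 hε1 hn0 hm0 ω.1 ω.2 (x i) (x j)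
      (fun l => (h2 (i, l)).le) (fun l => (h2 (j, l)).le) (by positivity)
    have e3 := abs_integral_riemannKernel_sub_kernel_le hρ μ hε0 hε1 hn0 (hx i) (hx j)
    -- The halved mesh is what makes `n ≥ 1 / ε₀` enough, as `1 + ε < 2`.
    have e4 : (1 + ε) / n * (1 / 2) ≤ ε₀ := by
      rw [div_le_iff₀ hε₀] at hn
      rw [div_mul_eq_mul_div, div_le_iff₀ hnR]
      linarith
    simp only at e1
    rw [abs_le] at e2 e3 ⊢
    rw [abs_lt] at e1
    constructor <;> linarith
  have htot : 1 ≤ Q.real good + (δ₁ + δ₂) := by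
    calc 1 = Q.real Set.univ := probReal_univ.symm
      _ ≤ Q.real (good ∪ ((⋃ q, bad₁ q) ∪ ⋃ q, bad₂ q)) := measureReal_mono hcover
      _ ≤ Q.real good + Q.real ((⋃ q, bad₁ q) ∪ ⋃ q, bad₂ q) := measureReal_union_le _ _
      _ ≤ Q.real good + (Q.real (⋃ q, bad₁ q) + Q.real (⋃ q, bad₂ q)) := by
          gcongr
          exact measureReal_union_le _ _
      _ ≤ _ := by linarith
  linarith
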